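/- All Hilbert spaces are complex and separable. For a Hilbert space $\mathcal E$, let $H^2_{\mathcal E}(\mathbb D)$ be the Hardy space of power series $f(z)=\sum_{n\ge 0}a_nz^n$ with $a_n\in\mathcal E$ and $\|f\|^2=\sum_n\|a_n\|^2<\infty$, regarded as analytic functions on the open unit disc $\mathbb D$, and let $M_z$ be the operator $(M_zf)(z)=zf(z)$. An operator $A\in\mathcal B(\mathcal E)$ also acts on $H^2_{\mathcal E}(\mathbb D)$ by $(Af)(z)=A(f(z))$, and $w(A)=\sup\{|\langle Ax,x\rangle| : \|x\|=1\}$ is its numerical radius. A bounded analytic function $\Theta:\mathbb D\to\mathcal B(\mathcal E,\mathcal E_*)$ is inner if the multiplication operator $M_\Theta:H^2_{\mathcal E}(\mathbb D)\to H^2_{\mathcal E_*}(\mathbb D)$, $(M_\Theta f)(z)=\Theta(z)f(z)$, is an isometry. A Beurling–Lax–Halmos representation of a closed subspace $\mathcal S\subseteq H^2_{\mathcal E_*}(\mathbb D)$ is a pair of a Hilbert space $\mathcal E$ and an inner function $\Theta:\mathbb D\to\mathcal B(\mathcal E,\mathcal E_*)$ with $\mathcal S=M_\Theta H^2_{\mathcal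 E}(\mathbb D)$. Theorem. Let $\mathcal S\neq\{0\}$ be a closed subspace of $H^2_{\mathcal E_*}(\mathbb D)$ and let $A\in\mathcal B(\mathcal E_*)$ satisfy $w(A)\le 1$. Then $\mathcal S$ is invariant under both $M_z$ and $A+A^*M_z$ if and only if there are a Beurling–Lax–Halmos representation $(\mathcal E,\Theta)$ of $\mathcal S$ and an operator $B\in\mathcal B(\mathcal E)$ with $w(B)\le 1$ such that $$(A+A^*M_z)M_\Theta=M_\Theta(B+B^*M_z).\qquad(1)$$ Moreover, for every Beurling–Lax–Halmos representation $(\mathcal E,\Theta)$ of $\mathcal S$, the subspace $\mathcal S$ is invariant under both $M_z$ and $A+A^*M_z$ if and only if there is $B\in\mathcal B(\mathcal E)$ with $w(B)\le1$ satisfying (1), and such a $B$ is unique. Finally, $B$ does not depend on the representation up to unitary equivalence: if $(\mathcal E,\Theta)$ and $(\mathcal E',\Theta')$ are two such representations of $\mathcal S$, and $B\in\mathcal B(\mathcal E)$ and $B'\in\mathcal B(\mathcal E')$ with $w(B)\le1$, $w(B')\le1$ satisfy (1) with $\Theta$ and $\Theta'$ respectively, then there is a unitary operator $W:\mathcal E\to\mathcal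 E'$ such that $\Theta(z)=\Theta'(z)W$ for all $z\in\mathbb D$ and $WB=B'W$. -/

import Mathlib

open scoped ENNReal

universe u v w

/-- The Hardy space `H²_E(𝔻)`: power series `∑ aₙ zⁿ` with coefficients in `E` and
`‖f‖² = ∑ ‖aₙ‖² < ∞`; an element is its sequence of coefficients, and `HardySpace.eval` is the
analytic function on the unit disc that it defines. -/
abbrev HardySpace (E : Type*) [NormedAddCommGroup E] : Type _ := lp (fun _ : ℕ => E) 2

/-- The value `f(z) = ∑ zⁿ aₙ` of `f ∈ H²_E(𝔻)` at a point `z` of the open unit disc. -/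
noncomputable def HardySpace.eval {E : Type*} [NormedAddCommGroup E] [InnerProductSpace ℂ E]
    (f : HardySpace E) (z : ℂ) : E :=
  ∑' n : ℕ, z ^ n • f n

theorem HardySpace.summable_eval {E : Type*} [NormedAddCommGroup E] [InnerProductSpace ℂ E]
    [CompleteSpace E] (f : HardySpace E) {z : ℂ} (hz : z ∈ Metric.ball (0 : ℂ) 1) :
    Summable fun n : ℕ => z ^ n • f n := by
  have hz' : ‖z‖ < 1 := by simpa using hz
  refine Summable.of_norm_bounded
    ((summable_geometric_of_lt_one (norm_nonneg z) hz').mul_right ‖f‖) fun n => ?_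
  rw [norm_smul, norm_pow]
  exact mul_le_mul_of_nonneg_left (lp.norm_apply_le_norm (by norm_num) f n) (by positivity)

/-- An element of the Hardy space is determined by its values on the disc. -/
theorem HardySpace.ext_eval {E : Type*} [NormedAddCommGroup E] [InnerProductSpace ℂ E]
    [CompleteSpace E] {f g : HardySpace E}
    (h : ∀ z ∈ Metric.ball (0 : ℂ) 1, f.eval z = g.eval z) : f = g := by
  have key : ∀ u : HardySpace E, HasFPowerSeriesAt u.eval
      (fun n => ContinuousMultilinearMap.mkPiRing ℂ (Fin n) (u n)) 0 := by
    intro u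
    refine ⟨1, ?_, by norm_num, ?_⟩
    · refine FormalMultilinearSeries.le_radius_of_bound (r := 1) _ ‖u‖ fun n => ?_
      simpa using lp.norm_apply_le_norm (by norm_num) u n
    · intro y hy
      have hy' : y ∈ Metric.ball (0 : ℂ) 1 := by
        simpa [← Metric.eball_ofReal] using hy
      simpa [HardySpace.eval] using (u.summable_eval hy').hasSum
  have e := HasFPowerSeriesAt.eq_formalMultilinearSeries_of_eventually (key f) (key g)
    (Filter.eventually_of_mem (Metric.ball_mem_nhds (0 : ℂ) one_pos) h)
  refine lp.ext (funext fun n => ?_)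
  have := congrArg (fun p => p n fun _ => (1 : ℂ)) e
  simpa using this

/-- `T : H²_E(𝔻) → H²_F(𝔻)` is multiplication by `Φ`: `(T f)(z) = Φ(z) f(z)` on the disc. -/
def IsMulBy {E F : Type*} [NormedAddCommGroup E] [InnerProductSpace ℂ E]
    [NormedAddCommGroup F] [InnerProductSpace ℂ F]
    (Φ : ℂ → E →L[ℂ] F) (T : HardySpace E →L[ℂ] HardySpace F) : Prop :=
  ∀ f : HardySpace E, ∀ z ∈ Metric.ball (0 : ℂ) 1, (T f).eval z = Φ z (f.eval z)

/-- `Φ : 𝔻 → B(E, F)` is a multiplier from `H²_E(𝔻)` to `H²_F(𝔻)`. Only the values of `Φ` on the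
open unit disc matter. -/
def IsMultiplier {E F : Type*} [NormedAddCommGroup E] [InnerProductSpace ℂ E]
    [NormedAddCommGroup F] [InnerProductSpace ℂ F] (Φ : ℂ → E →L[ℂ] F) : Prop :=
  ∃ T : HardySpace E →L[ℂ] HardySpace F, IsMulBy Φ T

open scoped Classical in
/-- The multiplication operator `M_Φ f = Φ f` of a multiplier `Φ` (and `0` if `Φ` is not one). -/
noncomputable def mulOp {E F : Type*} [NormedAddCommGroup E] [InnerProductSpace ℂ E]
    [NormedAddCommGroup F] [InnerProductSpace ℂ F] (Φ : ℂ → E →L[ℂ] F) :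
    HardySpace E →L[ℂ] HardySpace F :=
  if h : IsMultiplier Φ then h.choose else 0

theorem IsMultiplier.isMulBy_mulOp {E F : Type*} [NormedAddCommGroup E] [InnerProductSpace ℂ E]
    [NormedAddCommGroup F] [InnerProductSpace ℂ F] {Φ : ℂ → E →L[ℂ] F} (h : IsMultiplier Φ) :
    IsMulBy Φ (mulOp Φ) := by
  rw [mulOp, dif_pos h]
  exact h.choose_spec

theorem IsMulBy.mulOp_eq {E F : Type*} [NormedAddCommGroup E] [InnerProductSpace ℂ E]
    [NormedAddCommGroup F] [InnerProductSpace ℂ F] [CompleteSpace F] {Φ : ℂ → E →L[ℂ] F}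
    {T : HardySpace E →L[ℂ] HardySpace F} (h : IsMulBy Φ T) : mulOp Φ = T :=
  ContinuousLinearMap.ext fun f => HardySpace.ext_eval fun z hz => by
    rw [h f z hz, (IsMultiplier.isMulBy_mulOp ⟨T, h⟩) f z hz]

/-- The multiplication operator `M_z` on `H²_E(𝔻)`. -/
noncomputable def mulZ (E : Type*) [NormedAddCommGroup E] [InnerProductSpace ℂ E] :
    HardySpace E →L[ℂ] HardySpace E :=
  mulOp fun z => z • ContinuousLinearMap.id ℂ E

/-- Multiplication by a constant operator: `A` as the operator `f ↦ A f` on Hardy space,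
that is, `I ⊗ A`. -/
noncomputable def mulConst {E F : Type*} [NormedAddCommGroup E] [InnerProductSpace ℂ E]
    [NormedAddCommGroup F] [InnerProductSpace ℂ F] (A : E →L[ℂ] F) :
    HardySpace E →L[ℂ] HardySpace F :=
  mulOp fun _ => A

/-- The coordinate function is a multiplier, so `M_z` is not a default value. -/
theorem isMultiplier_z (E : Type*) [NormedAddCommGroup E] [InnerProductSpace ℂ E]
    [CompleteSpace E] : IsMultiplier fun z : ℂ => z • ContinuousLinearMap.id ℂ E := by
  let s : HardySpace E → ℕ → E := fun f n => Nat.casesOn n 0 fun k => f k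
  have hp : 0 < (2 : ℝ≥0∞).toReal := by norm_num
  have hsum : ∀ f : HardySpace E,
      HasSum (fun n => ‖s f n‖ ^ (2 : ℝ≥0∞).toReal) (‖f‖ ^ (2 : ℝ≥0∞).toReal) := by
    intro f
    rw [← hasSum_nat_add_iff' 1]
    simpa [s] using lp.hasSum_norm hp f
  let L : HardySpace E →ₗ[ℂ] HardySpace E :=
    { toFun := fun f => ⟨s f, memℓp_gen (hsum f).summable⟩
      map_add' := fun f g => lp.ext (funext fun n => by
        cases n with
        | zero => exact (add_zero (0 : E)).symm
        | succ k => rfl)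
      map_smul' := fun c f => lp.ext (funext fun n => by cases n <;> simp [s]) }
  refine ⟨L.mkContinuous 1 fun f => ?_, fun f z hz => ?_⟩
  · rw [one_mul]
    exact lp.norm_le_of_tsum_le hp (norm_nonneg f) (hsum f).tsum_eq.le
  · have h0 : Summable fun n : ℕ => z ^ n • s f n :=
      (L f).summable_eval hz
    change ∑' n : ℕ, z ^ n • s f n = z • ∑' n : ℕ, z ^ n • f n
    rw [h0.tsum_eq_zero_add, ← (f.summable_eval hz).tsum_const_smul]
    simp [s, pow_succ', mul_smul]

/-- Constant operators are multipliers. -/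
theorem isMultiplier_const {E F : Type*} [NormedAddCommGroup E] [InnerProductSpace ℂ E]
    [CompleteSpace E] [NormedAddCommGroup F] [InnerProductSpace ℂ F] (A : E →L[ℂ] F) :
    IsMultiplier fun _ : ℂ => A := by
  have hb : ∀ (f : HardySpace E) n, ‖A (f n)‖ ≤ ‖(((‖A‖ : ℝ) : ℂ) • f) n‖ := fun f n => by
    rw [lp.coeFn_smul, Pi.smul_apply, norm_smul, Complex.norm_real, norm_norm]
    exact A.le_opNorm (f n)
  let L : HardySpace E →ₗ[ℂ] HardySpace F :=
    { toFun := fun f => ⟨fun n => A (f n), (lp.memℓp (((‖A‖ : ℝ) : ℂ) • f)).mono' (hb f)⟩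
      map_add' := fun f g => lp.ext (funext fun n => A.map_add (f n) (g n))
      map_smul' := fun c f => lp.ext (funext fun n => by simp) }
  refine ⟨L.mkContinuous ‖A‖ fun f => ?_, fun f z hz => ?_⟩
  · refine (lp.norm_mono (by norm_num) (y := ((‖A‖ : ℝ) : ℂ) • f) (hb f)).trans ?_
    rw [norm_smul, Complex.norm_real, norm_norm]
  · change ∑' n : ℕ, z ^ n • A (f n) = A (∑' n : ℕ, z ^ n • f n)
    rw [A.map_tsum (f.summable_eval hz)]
    simp

/-- `A + A* M_z`, the analytic Toeplitz operator with symbol `A + A* z`, on `H²_E(𝔻)`. -/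
noncomputable def gammaOp {E : Type*} [NormedAddCommGroup E] [InnerProductSpace ℂ E]
    [CompleteSpace E] (A : E →L[ℂ] E) : HardySpace E →L[ℂ] HardySpace E :=
  mulConst A + mulConst (ContinuousLinearMap.adjoint A) ∘L mulZ E

/-- The numerical radius `w(A) = sup {|⟨A x, x⟩| : ‖x‖ = 1}`. -/
noncomputable def numericalRadius {E : Type*} [NormedAddCommGroup E] [InnerProductSpace ℂ E]
    (A : E →L[ℂ] E) : ℝ :=
  ⨆ x : Metric.sphere (0 : E) 1, ‖inner ℂ (A (x : E)) (x : E)‖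

/-- The supremum in the definition of the numerical radius is that of a bounded set. -/
theorem bddAbove_numericalRadius {E : Type*} [NormedAddCommGroup E] [InnerProductSpace ℂ E]
    (A : E →L[ℂ] E) :
    BddAbove (Set.range fun x : Metric.sphere (0 : E) 1 => ‖inner ℂ (A (x : E)) (x : E)‖) := by
  refine ⟨‖A‖, ?_⟩
  rintro _ ⟨⟨x, hx⟩, rfl⟩
  have hx' : ‖x‖ = 1 := by simpa using hx
  have h1 := norm_inner_le_norm (𝕜 := ℂ) (A x) x
  have h2 := A.le_opNorm x
  rw [hx', mul_one] at h1 h2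
  exact h1.trans h2

/-- `Θ ∈ H^∞_{B(E, F)}(𝔻)` is an inner function: a bounded analytic function on the open unit disc
whose multiplication operator `M_Θ : H²_E(𝔻) → H²_F(𝔻)` is an isometry. -/
structure IsInnerFunction {E F : Type*} [NormedAddCommGroup E] [InnerProductSpace ℂ E]
    [NormedAddCommGroup F] [InnerProductSpace ℂ F] (Θ : ℂ → E →L[ℂ] F) : Prop where
  analytic : DifferentiableOn ℂ Θ (Metric.ball 0 1)
  bounded : ∃ C : ℝ, ∀ z ∈ Metric.ball (0 : ℂ) 1, ‖Θ z‖ ≤ C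
  multiplier : IsMultiplier Θ
  isometry : ∀ f : HardySpace E, ‖mulOp Θ f‖ = ‖f‖

/-- `Θ` is a Beurling–Lax–Halmos representation of `S ⊆ H²_F(𝔻)`: `Θ` is inner and
`S = Θ H²_E(𝔻)`. -/
def IsBLHRepresentation {E F : Type*} [NormedAddCommGroup E] [InnerProductSpace ℂ E]
    [NormedAddCommGroup F] [InnerProductSpace ℂ F] (S : Submodule ℂ (HardySpace F))
    (Θ : ℂ → E →L[ℂ] F) : Prop :=
  IsInnerFunction Θ ∧ (S : Set (HardySpace F)) = Set.range (mulOp Θ)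

/-- `S` is a submodule of the `Γ`-isometric Hardy module `[H²_F(𝔻)]_A`, the Hilbert module over
`ℂ[z₁, z₂]` in which the coordinate functions act as `A + A* M_z` and `M_z`: it is invariant under
both of these operators. -/
def IsGammaSubmodule {F : Type*} [NormedAddCommGroup F] [InnerProductSpace ℂ F] [CompleteSpace F]
    (A : F →L[ℂ] F) (S : Submodule ℂ (HardySpace F)) : Prop :=
  (∀ f ∈ S, gammaOp A f ∈ S) ∧ (∀ f ∈ S, mulZ F f ∈ S)

/-- `w(B) ≤ 1` and `(A + A* M_z) M_Θ = M_Θ (B + B* M_z)`. -/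
def IsGammaSolution {E F : Type*} [NormedAddCommGroup E] [InnerProductSpace ℂ E] [CompleteSpace E]
    [NormedAddCommGroup F] [InnerProductSpace ℂ F] [CompleteSpace F]
    (A : F →L[ℂ] F) (Θ : ℂ → E →L[ℂ] F) (B : E →L[ℂ] E) : Prop :=
  numericalRadius B ≤ 1 ∧ gammaOp A ∘L mulOp Θ = mulOp Θ ∘L gammaOp B

/-! Write Γ_A for `gammaOp A`. On the unit circle A + ζA* = ζ(A + ζA*)*, so Γ_A = Γ_A* M_z, and Γ_A
commutes with M_z. Conversely, by `exists_eq_gammaOp`, any bounded X with these two properties is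
Γ_B for some B. If M_Θ is isometric with range S and S is invariant, then X = M_Θ* Γ_A M_Θ satisfies
M_Θ X = Γ_A M_Θ, and both properties pass from Γ_A to X. This produces B.

The bound w(B) ≤ 1 is transported in the same way, because w(A) ≤ 1 is equivalent to |⟨Γ_A f, f⟩| ≤
2‖f‖² for all f (`norm_inner_gammaOp_self_le`, `numericalRadius_le_of_gammaOp`), and this form of
the bound is inherited by X.

Uniqueness follows from injectivity of M_Θ, since B is read off from the constant coefficients of
Γ_B on constants. For two representations, M_Θ and M_Θ' carry the constants onto the same subspace S
⊖ zS, which gives the unitary W; comparing constant coefficients gives WB = B'W.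

The existence of some representation is the Beurling–Lax–Halmos theorem, proved through the Wold
decomposition S = ⊕ zⁿ(S ⊖ zS) (`range_linearIsometry_wandering`). -/

set_option linter.unusedSectionVars false

/-! ### Coefficients, the shift and the operators A + A* M_z -/

namespace HardySpace

variable {E F : Type*} [NormedAddCommGroup E] [InnerProductSpace ℂ E]
  [NormedAddCommGroup F] [InnerProductSpace ℂ F]

/-- The constant function with value `x`. -/
noncomputable def const (x : E) : HardySpace E := lp.single 2 0 x

@[simp]
theorem const_zero_coeff (x : E) : const x 0 = x := lp.single_apply_self _ _ _

@[simp]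
theorem const_succ_coeff (x : E) (n : ℕ) : const x (n + 1) = 0 :=
  lp.single_apply_ne _ _ _ (Nat.succ_ne_zero n)

@[simp]
theorem norm_const (x : E) : ‖const x‖ = ‖x‖ := lp.norm_single (by norm_num) _ _

theorem const_add (x y : E) : const (x + y) = const x + const y := lp.single_add _ _ _ _

theorem const_smul (c : ℂ) (x : E) : const (c • x) = c • const x := lp.single_smul _ _ _ _

/-- The constant functions, as a linear isometry. -/
noncomputable def constL (E : Type*) [NormedAddCommGroup E] [InnerProductSpace ℂ E] :
    E →ₗᵢ[ℂ] HardySpace E where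
  toFun := const
  map_add' := const_add
  map_smul' := const_smul
  norm_map' := norm_const

/-- The `n`-th coefficient, as a continuous linear map. -/
noncomputable def coeffL (E : Type*) [NormedAddCommGroup E] [InnerProductSpace ℂ E] (n : ℕ) :
    HardySpace E →L[ℂ] E :=
  LinearMap.mkContinuous
    { toFun := fun f => f n
      map_add' := fun _ _ => rfl
      map_smul' := fun _ _ => rfl } 1 fun f => by
    rw [one_mul]
    exact lp.norm_apply_le_norm (by norm_num) f n

theorem norm_coeffL_le (n : ℕ) : ‖coeffL E n‖ ≤ 1 :=
  LinearMap.mkContinuous_norm_le _ zero_le_one _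

/-- The value at a point of the disc, as a continuous linear map. -/
noncomputable def evalL (E : Type*) [NormedAddCommGroup E] [InnerProductSpace ℂ E]
    [CompleteSpace E] (z : ℂ) (hz : z ∈ Metric.ball (0 : ℂ) 1) : HardySpace E →L[ℂ] E :=
  LinearMap.mkContinuous
    { toFun := fun f => f.eval z
      map_add' := fun f g => by
        simp only [eval, lp.coeFn_add, Pi.add_apply, smul_add]
        exact (f.summable_eval hz).tsum_add (g.summable_eval hz)
      map_smul' := fun c f => by
        simp only [eval, lp.coeFn_smul, Pi.smul_apply, smul_comm _ c]
        exact (f.summable_eval hz).tsum_const_smul c } (1 - ‖z‖)⁻¹ fun f => by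
    have hz' : ‖z‖ < 1 := by simpa using hz
    refine tsum_of_norm_bounded
      ((hasSum_geometric_of_lt_one (norm_nonneg z) hz').mul_right ‖f‖) fun n => ?_
    rw [norm_smul, norm_pow]
    exact mul_le_mul_of_nonneg_left (lp.norm_apply_le_norm (by norm_num) f n) (by positivity)

@[simp]
theorem evalL_apply [CompleteSpace E] {z : ℂ} (hz : z ∈ Metric.ball (0 : ℂ) 1)
    (f : HardySpace E) : evalL E z hz f = f.eval z := rfl

@[simp]
theorem eval_const (x : E) (z : ℂ) : (const x).eval z = x := by
  rw [eval, tsum_eq_single 0]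
  · simp
  · rintro (_ | n) hn
    · exact absurd rfl hn
    · simp

/-- `mulZ` comes from a choice of multiplication operator and has no visible coefficients; this
explicit shift has the same values on the disc, so `ext_eval` identifies the two. -/
theorem exists_mulZ (f : HardySpace E) : ∃ g : HardySpace E, ‖g‖ = ‖f‖ ∧ g 0 = 0 ∧
    ∀ n, g (n + 1) = f n := by
  let s : ℕ → E := fun n => Nat.casesOn n 0 fun k => f k
  have hp : 0 < (2 : ℝ≥0∞).toReal := by norm_num
  have hsum : HasSum (fun n => ‖s n‖ ^ (2 : ℝ≥0∞).toReal) (‖f‖ ^ (2 : ℝ≥0∞).toReal) := by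
    rw [← hasSum_nat_add_iff' 1]
    simpa [s] using lp.hasSum_norm hp f
  refine ⟨⟨s, memℓp_gen hsum.summable⟩, ?_, rfl, fun n => rfl⟩
  refine Real.rpow_left_injOn hp.ne' (norm_nonneg _) (norm_nonneg _) ?_
  exact (lp.hasSum_norm hp (⟨s, memℓp_gen hsum.summable⟩ : HardySpace E)).unique hsum

variable [CompleteSpace E]

theorem eval_mulZ (f : HardySpace E) {z : ℂ} (hz : z ∈ Metric.ball (0 : ℂ) 1) :
    (mulZ E f).eval z = z • f.eval z := by
  have h : (mulZ E f).eval z = (z • ContinuousLinearMap.id ℂ E) (f.eval z) :=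
    (isMultiplier_z E).isMulBy_mulOp f z hz
  simpa using h

theorem mulZ_coeff (f : HardySpace E) :
    ‖mulZ E f‖ = ‖f‖ ∧ mulZ E f 0 = 0 ∧ ∀ n, mulZ E f (n + 1) = f n := by
  obtain ⟨g, h, h0, h1⟩ := exists_mulZ f
  have : mulZ E f = g := ext_eval fun z hz => by
    rw [eval_mulZ f hz, eval, eval, (g.summable_eval hz).tsum_eq_zero_add,
      ← (f.summable_eval hz).tsum_const_smul]
    simp [h0, h1, pow_succ', mul_smul]
  rw [this]
  exact ⟨h, h0, h1⟩

@[simp]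
theorem norm_mulZ (f : HardySpace E) : ‖mulZ E f‖ = ‖f‖ := (mulZ_coeff f).1

@[simp]
theorem mulZ_zero_coeff (f : HardySpace E) : mulZ E f 0 = 0 := (mulZ_coeff f).2.1

@[simp]
theorem mulZ_succ_coeff (f : HardySpace E) (n : ℕ) : mulZ E f (n + 1) = f n := (mulZ_coeff f).2.2 n

/-- The shift as a linear isometry. -/
noncomputable def mulZₗᵢ (E : Type*) [NormedAddCommGroup E] [InnerProductSpace ℂ E]
    [CompleteSpace E] : HardySpace E →ₗᵢ[ℂ] HardySpace E :=
  ⟨(mulZ E).toLinearMap, norm_mulZ⟩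

@[simp]
theorem inner_mulZ_mulZ (f g : HardySpace E) :
    inner ℂ (mulZ E f) (mulZ E g) = inner ℂ f g :=
  (mulZₗᵢ E).inner_map_map f g

@[simp]
theorem inner_const_left (x : E) (f : HardySpace E) : inner ℂ (const x) f = inner ℂ x (f 0) :=
  lp.inner_single_left 0 x f

@[simp]
theorem mulConst_coeff [CompleteSpace F] (A : E →L[ℂ] F) (f : HardySpace E) (n : ℕ) :
    mulConst A f n = A (f n) := by
  have hb : ∀ n, ‖A (f n)‖ ≤ ‖(((‖A‖ : ℝ) : ℂ) • f) n‖ := fun n => by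
    rw [lp.coeFn_smul, Pi.smul_apply, norm_smul, Complex.norm_real, norm_norm]
    exact A.le_opNorm (f n)
  let g : HardySpace F := ⟨fun n => A (f n), (lp.memℓp (((‖A‖ : ℝ) : ℂ) • f)).mono' hb⟩
  have : mulConst A f = g := ext_eval fun z hz => by
    have h1 : (mulConst A f).eval z = A (f.eval z) :=
      (isMultiplier_const A).isMulBy_mulOp f z hz
    rw [h1, eval, eval, A.map_tsum (f.summable_eval hz)]
    simp [g]
  rw [this]

theorem iterate_mulZ_const (x : E) (n : ℕ) : (mulZ E)^[n] (const x) = lp.single 2 n x := by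
  induction n with
  | zero => rfl
  | succ n ih =>
    rw [Function.iterate_succ_apply', ih]
    refine lp.ext (funext fun k => ?_)
    cases k with
    | zero => simp
    | succ k => simp [Pi.single_apply]

theorem hasSum_iterate_mulZ (f : HardySpace E) :
    HasSum (fun n => (mulZ E)^[n] (const (f n))) f := by
  simp only [iterate_mulZ_const]
  exact lp.hasSum_single (by norm_num) f

/-- A continuous linear map intertwining the shifts is determined by its values on constants. -/
theorem ext_of_commute_mulZ [CompleteSpace F] {T R : HardySpace E →L[ℂ] HardySpace F}
    (hT : ∀ f, T (mulZ E f) = mulZ F (T f)) (hR : ∀ f, R (mulZ E f) = mulZ F (R f))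
    (h : ∀ x, T (const x) = R (const x)) : T = R := by
  refine ContinuousLinearMap.ext fun f => ?_
  have key : ∀ Q : HardySpace E →L[ℂ] HardySpace F, (∀ f, Q (mulZ E f) = mulZ F (Q f)) →
      HasSum (fun n => (mulZ F)^[n] (Q (const (f n)))) (Q f) := by
    intro Q hQ
    have h1 : ∀ n g, Q ((mulZ E)^[n] g) = (mulZ F)^[n] (Q g) := fun n =>
      Function.Semiconj.iterate_right (f := Q) (fun g => hQ g) n
    simpa only [Function.comp_def, h1] using (hasSum_iterate_mulZ f).mapL Q
  refine (key T hT).unique ?_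
  simpa only [h] using key R hR

@[simp]
theorem gammaOp_zero_coeff (A : E →L[ℂ] E) (f : HardySpace E) : gammaOp A f 0 = A (f 0) := by
  simp [gammaOp]

@[simp]
theorem gammaOp_succ_coeff (A : E →L[ℂ] E) (f : HardySpace E) (n : ℕ) :
    gammaOp A f (n + 1) = A (f (n + 1)) + ContinuousLinearMap.adjoint A (f n) := by
  simp [gammaOp]

theorem gammaOp_mulZ (A : E →L[ℂ] E) (f : HardySpace E) :
    gammaOp A (mulZ E f) = mulZ E (gammaOp A f) := by
  refine lp.ext (funext fun k => ?_)
  rcases k with _ | _ | k <;> simp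

theorem gammaOp_const (A : E →L[ℂ] E) (x : E) : gammaOp A (const x) =
    const (A x) + mulZ E (const (ContinuousLinearMap.adjoint A x)) := by
  refine lp.ext (funext fun k => ?_)
  rcases k with _ | _ | k <;> simp

theorem inner_mulConst_left [CompleteSpace F] (A : E →L[ℂ] F) (f : HardySpace E)
    (g : HardySpace F) :
    inner ℂ (mulConst A f) g = inner ℂ f (mulConst (ContinuousLinearMap.adjoint A) g) := by
  rw [lp.inner_eq_tsum, lp.inner_eq_tsum]
  simp only [mulConst_coeff, ContinuousLinearMap.adjoint_inner_right]

theorem mulConst_mulZ [CompleteSpace F] (A : E →L[ℂ] F) (f : HardySpace E) :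
    mulConst A (mulZ E f) = mulZ F (mulConst A f) := by
  refine lp.ext (funext fun k => ?_)
  cases k <;> simp

theorem gammaOp_apply (A : E →L[ℂ] E) (f : HardySpace E) : gammaOp A f =
    mulConst A f + mulConst (ContinuousLinearMap.adjoint A) (mulZ E f) := rfl

/-- This is Γ = Γ* M_z, the Toeplitz form of A + ζA* = ζ(A + ζA*)* for |ζ| = 1. Taking adjoints of
the constant factors swaps the two summands, and M_z is an isometry commuting with constants. -/
theorem inner_gammaOp_left (A : E →L[ℂ] E) (f g : HardySpace E) :
    inner ℂ (gammaOp A f) g = inner ℂ (mulZ E f) (gammaOp A g) := by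
  rw [gammaOp_apply, gammaOp_apply, inner_add_left, inner_add_right, mulConst_mulZ,
    ← mulConst_mulZ (ContinuousLinearMap.adjoint A) f, inner_mulConst_left, inner_mulConst_left,
    ContinuousLinearMap.adjoint_adjoint, mulConst_mulZ (ContinuousLinearMap.adjoint A) g,
    inner_mulZ_mulZ, add_comm]

end HardySpace

/-! ### The numerical radius of A + A* M_z -/

theorem norm_inner_map_self_le_of_numericalRadius_le {E : Type*} [NormedAddCommGroup E]
    [InnerProductSpace ℂ E] {A : E →L[ℂ] E} {c : ℝ} (hA : numericalRadius A ≤ c) (x : E) :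
    ‖inner ℂ (A x) x‖ ≤ c * ‖x‖ ^ 2 := by
  rcases eq_or_ne x 0 with rfl | hx
  · simp
  have hx' : ‖x‖ ≠ 0 := norm_ne_zero_iff.2 hx
  have hc : ((‖x‖ : ℝ) : ℂ) ≠ 0 := by exact_mod_cast hx'
  let y : E := ((‖x‖ : ℝ) : ℂ)⁻¹ • x
  have hy : y ∈ Metric.sphere (0 : E) 1 := by
    simp [y, norm_smul, hx']
  have h := (le_ciSup (bddAbove_numericalRadius A) ⟨y, hy⟩).trans hA
  have hxy : x = ((‖x‖ : ℝ) : ℂ) • y := by simp [y, smul_smul, hc]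
  have e : ‖inner ℂ (A x) x‖ = ‖inner ℂ (A y) y‖ * ‖x‖ ^ 2 := by
    conv_lhs => rw [hxy]
    simp only [map_smul, inner_smul_left, inner_smul_right, norm_mul, RCLike.norm_conj,
      Complex.norm_real, norm_norm]
    ring
  rw [e]
  exact mul_le_mul_of_nonneg_right h (by positivity)

/-- Parseval's identity for the finite Fourier transform of vector-valued functions. -/
theorem IsPrimitiveRoot.sum_inner_sum_pow_smul {E : Type*} [NormedAddCommGroup E]
    [InnerProductSpace ℂ E] {M : ℕ} {ω : ℂ} (hω : IsPrimitiveRoot ω M) (hM : 0 < M)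
    (u v : ℕ → E) :
    ∑ k ∈ Finset.range M, inner ℂ (∑ n ∈ Finset.range M, (ω ^ k) ^ n • u n)
      (∑ m ∈ Finset.range M, (ω ^ k) ^ m • v m) =
    M * ∑ n ∈ Finset.range M, inner ℂ (u n) (v n) := by
  have hnorm : ‖ω‖ = 1 := hω.norm'_eq_one hM.ne'
  have hconj : (starRingEnd ℂ) ω = ω⁻¹ := (Complex.inv_eq_conj hnorm).symm
  have h0 : ω ≠ 0 := hω.ne_zero hM.ne'
  have key : ∀ n ∈ Finset.range M, ∀ m ∈ Finset.range M,
      ∑ k ∈ Finset.range M, inner ℂ ((ω ^ k) ^ n • u n) ((ω ^ k) ^ m • v m) =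
        if n = m then M * inner ℂ (u n) (v n) else 0 := by
    intro n hn m hm
    have e : ∀ k, inner ℂ ((ω ^ k) ^ n • u n) ((ω ^ k) ^ m • v m) =
        (ω ^ m / ω ^ n) ^ k * inner ℂ (u n) (v m) := fun k => by
      rw [inner_smul_left, inner_smul_right, map_pow, map_pow, hconj, ← mul_assoc]
      congr 1
      rw [div_pow, ← pow_mul, ← pow_mul, ← pow_mul, ← pow_mul, mul_comm m, mul_comm n, inv_pow,
        div_eq_inv_mul]
    simp only [e, ← Finset.sum_mul]
    split_ifs with h
    · subst h
      simp [div_self (pow_ne_zero n h0)]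
    · have h1 : ω ^ m / ω ^ n ≠ 1 := fun h1 => h
        (hω.pow_inj (Finset.mem_range.1 hn) (Finset.mem_range.1 hm)
          ((div_eq_one_iff_eq (pow_ne_zero n h0)).1 h1).symm)
      have h2 : (ω ^ m / ω ^ n) ^ M = 1 := by
        rw [div_pow, ← pow_mul, ← pow_mul, mul_comm m, mul_comm n, pow_mul, pow_mul, hω.pow_eq_one]
        simp
      rw [geom_sum_eq h1, h2, sub_self, zero_div, zero_mul]
  simp only [sum_inner, inner_sum]
  rw [Finset.sum_comm, Finset.mul_sum]
  refine Finset.sum_congr rfl fun n hn => ?_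
  rw [Finset.sum_comm, Finset.sum_congr rfl fun m hm => key m hm n hn]
  simp [Finset.mem_range.1 hn]

namespace HardySpace

variable {E : Type*} [NormedAddCommGroup E] [InnerProductSpace ℂ E] [CompleteSpace E]

theorem inner_eq_sum_range {f g : HardySpace E} {N : ℕ} (hg : ∀ n, N ≤ n → g n = 0) :
    inner ℂ f g = ∑ n ∈ Finset.range N, inner ℂ (f n) (g n) := by
  rw [lp.inner_eq_tsum]
  refine tsum_eq_sum fun n hn => ?_
  rw [hg n (by simpa using hn), inner_zero_right]

/-- For a polynomial f, the pairing ⟨Γ_A f, f⟩ is the average over roots of unity ζ of ⟨(A +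
ζA*)f(ζ), f(ζ)⟩, and each of these is at most 2‖f(ζ)‖² in modulus. A finite average replaces the
integral over the circle. -/
theorem norm_inner_gammaOp_self_le_of_finite {A : E →L[ℂ] E} (hA : numericalRadius A ≤ 1)
    {f : HardySpace E} {N : ℕ} (hf : ∀ n, N ≤ n → f n = 0) :
    ‖inner ℂ (gammaOp A f) f‖ ≤ 2 * ‖f‖ ^ 2 := by
  -- The polynomial f has degree below N and Γ_A raises the degree by at most one, so N + 1 roots of
  -- unity suffice for both.
  let ω : ℂ := Complex.exp (2 * Real.pi * Complex.I / ((N + 1 : ℕ) : ℂ))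
  have hω : IsPrimitiveRoot ω (N + 1) := Complex.isPrimitiveRoot_exp _ N.succ_ne_zero
  have hnorm : ‖ω‖ = 1 := hω.norm'_eq_one N.succ_ne_zero
  have hf' : ∀ n, N + 1 ≤ n → f n = 0 := fun n hn => hf n (by omega)
  let p : ℕ → E := fun k => ∑ n ∈ Finset.range (N + 1), (ω ^ k) ^ n • f n
  have hp : ∀ k, ∑ n ∈ Finset.range (N + 1), (ω ^ k) ^ n • gammaOp A f n =
      A (p k) + ω ^ k • ContinuousLinearMap.adjoint A (p k) := fun k => by
    have e1 : A (p k) = ∑ n ∈ Finset.range (N + 1), (ω ^ k) ^ n • A (f n) := by simp [p]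
    have e2 : p k = ∑ n ∈ Finset.range N, (ω ^ k) ^ n • f n := by
      simp [p, Finset.sum_range_succ, hf N le_rfl]
    rw [e1, e2, Finset.sum_range_succ', Finset.sum_range_succ' _ N]
    simp only [gammaOp_succ_coeff, gammaOp_zero_coeff, map_sum, map_smul, smul_add,
      Finset.sum_add_distrib, Finset.smul_sum, smul_smul, pow_succ']
    abel
  have h1 := hω.sum_inner_sum_pow_smul N.succ_pos (fun n => gammaOp A f n) (fun n => f n)
  have h2 := hω.sum_inner_sum_pow_smul N.succ_pos (fun n => f n) (fun n => f n)
  rw [← inner_eq_sum_range hf'] at h1 h2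
  have h2' : ∑ k ∈ Finset.range (N + 1), ‖p k‖ ^ 2 = (N + 1 : ℕ) * ‖f‖ ^ 2 := by
    have : ((∑ k ∈ Finset.range (N + 1), ‖p k‖ ^ 2 : ℝ) : ℂ) =
        (((N + 1 : ℕ) * ‖f‖ ^ 2 : ℝ) : ℂ) := by
      push_cast
      simp only [inner_self_eq_norm_sq_to_K] at h2
      push_cast at h2
      exact h2
    exact_mod_cast this
  have h3 : ∀ k, ‖inner ℂ (A (p k) + ω ^ k • ContinuousLinearMap.adjoint A (p k)) (p k)‖ ≤
      2 * ‖p k‖ ^ 2 := fun k => by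
    have b := norm_inner_map_self_le_of_numericalRadius_le hA (p k)
    rw [inner_add_left, inner_smul_left, ContinuousLinearMap.adjoint_inner_left]
    refine (norm_add_le _ _).trans ?_
    rw [norm_mul, RCLike.norm_conj, norm_pow, hnorm, one_pow, one_mul,
      norm_inner_symm (p k)]
    linarith
  have h4 : ((N + 1 : ℕ) : ℝ) * ‖inner ℂ (gammaOp A f) f‖ ≤
      ((N + 1 : ℕ) : ℝ) * (2 * ‖f‖ ^ 2) := by
    calc ((N + 1 : ℕ) : ℝ) * ‖inner ℂ (gammaOp A f) f‖
        = ‖((N + 1 : ℕ) : ℂ) * inner ℂ (gammaOp A f) f‖ := by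
          rw [norm_mul, Complex.norm_natCast]
      _ ≤ ∑ k ∈ Finset.range (N + 1), 2 * ‖p k‖ ^ 2 := by
          rw [← h1]
          refine norm_sum_le_of_le _ fun k _ => ?_
          rw [hp k]
          exact h3 k
      _ = _ := by rw [← Finset.mul_sum, h2']; ring
  exact le_of_mul_le_mul_left h4 (by positivity)

theorem norm_inner_gammaOp_self_le {A : E →L[ℂ] E} (hA : numericalRadius A ≤ 1)
    (f : HardySpace E) : ‖inner ℂ (gammaOp A f) f‖ ≤ 2 * ‖f‖ ^ 2 := by
  have ht := (lp.hasSum_single (E := fun _ : ℕ => E) (p := 2) (by norm_num) f).tendsto_sum_nat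
  refine le_of_tendsto_of_tendsto'
    ((((gammaOp A).continuous.tendsto f).comp ht).inner ht).norm ((ht.norm.pow 2).const_mul 2)
    fun N => norm_inner_gammaOp_self_le_of_finite hA (N := N) fun n hn => ?_
  simp only [lp.coeFn_sum, Finset.sum_apply]
  refine Finset.sum_eq_zero fun k hk => lp.single_apply_ne _ _ _ ?_
  have := Finset.mem_range.1 hk
  omega

/-- Truncated geometric series ∑ cⁿzⁿx with |c| = 1 are approximate eigenvectors of the adjoint
shift; a suitable c makes the contributions of B and B* add up instead of cancelling. -/
theorem numericalRadius_le_of_gammaOp {B : E →L[ℂ] E}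
    (hB : ∀ f : HardySpace E, ‖inner ℂ (gammaOp B f) f‖ ≤ 2 * ‖f‖ ^ 2) :
    numericalRadius B ≤ 1 := by
  -- The side condition 0 ≤ 1 covers E = 0, where the unit sphere is empty and the supremum is 0 by
  -- convention.
  refine Real.iSup_le ?_ zero_le_one
  rintro ⟨x, hx⟩
  have hx' : ‖x‖ = 1 := by simpa using hx
  change ‖inner ℂ (B x) x‖ ≤ 1
  set β : ℂ := inner ℂ (B x) x with hβ
  -- The B* term in each coefficient past the first contributes c · conj β, which this phase turns
  -- into β.
  obtain ⟨c, hc, hcβ⟩ : ∃ c : ℂ, ‖c‖ = 1 ∧ c * (starRingEnd ℂ) β = β := by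
    rcases eq_or_ne β 0 with h | h
    · exact ⟨1, by simp, by simp [h]⟩
    · have h' : (starRingEnd ℂ) β ≠ 0 := by simpa using h
      exact ⟨β / (starRingEnd ℂ) β, by simp [h], div_mul_cancel₀ _ h'⟩
  have hcc : ∀ n : ℕ, (starRingEnd ℂ) (c ^ n) * c ^ n = 1 := fun n => by
    rw [← Complex.normSq_eq_conj_mul_self, Complex.normSq_eq_norm_sq, norm_pow, hc]
    simp
  -- Coefficient 0 contributes β, having no B* term, and each of the N others contributes 2β, while
  -- ‖f‖² = N + 1. Large N forces ‖β‖ ≤ 1.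
  have key : ∀ N : ℕ, (2 * N + 1) * ‖β‖ ≤ 2 * (N + 1) := fun N => by
    let f : HardySpace E := ∑ n ∈ Finset.range (N + 1), lp.single 2 n (c ^ n • x)
    have hfn : ∀ n, f n = if n < N + 1 then c ^ n • x else 0 := fun n => by
      simp only [f, lp.coeFn_sum, Finset.sum_apply, lp.coeFn_single, Pi.single_apply]
      simp
    have hf0 : ∀ n, N + 1 ≤ n → f n = 0 := fun n hn => by rw [hfn, if_neg (by omega)]
    have hn : ‖f‖ ^ 2 = N + 1 := by
      have : ((‖f‖ ^ 2 : ℝ) : ℂ) = ((N + 1 : ℝ) : ℂ) := by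
        push_cast
        have h1 : inner ℂ f f = (‖f‖ : ℂ) ^ 2 := inner_self_eq_norm_sq_to_K f
        rw [← h1, inner_eq_sum_range hf0]
        have : ∀ n ∈ Finset.range (N + 1), inner ℂ (f n) (f n) = (1 : ℂ) := fun n hn => by
          rw [hfn, if_pos (Finset.mem_range.1 hn), inner_smul_left, inner_smul_right, ← mul_assoc,
            hcc, inner_self_eq_norm_sq_to_K, hx']
          simp
        rw [Finset.sum_congr rfl this]
        simp
      exact_mod_cast this
    have hi : inner ℂ (gammaOp B f) f = (2 * N + 1) * β := by
      rw [inner_eq_sum_range hf0, Finset.sum_range_succ']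
      have : ∀ n ∈ Finset.range N, inner ℂ (gammaOp B f (n + 1)) (f (n + 1)) = β + β :=
        fun n hn => by
        have hn' := Finset.mem_range.1 hn
        rw [gammaOp_succ_coeff, hfn, hfn, if_pos (by omega), if_pos (by omega), map_smul, map_smul,
          inner_add_left, inner_smul_left, inner_smul_right, ← mul_assoc, hcc, inner_smul_left,
          inner_smul_right, pow_succ, ← mul_assoc, ← mul_assoc, hcc, one_mul, one_mul,
          ContinuousLinearMap.adjoint_inner_left, ← inner_conj_symm x (B x), ← hβ, hcβ]
      rw [Finset.sum_congr rfl this, gammaOp_zero_coeff, hfn]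
      simp [← hβ]
      ring
    have h := hB f
    rw [hi, hn, norm_mul] at h
    have : ‖(2 * N + 1 : ℂ)‖ = 2 * N + 1 := by
      have := Complex.norm_natCast (2 * N + 1)
      push_cast at this
      exact this
    rwa [this] at h
  by_contra! hlt
  obtain ⟨N, hN⟩ := exists_nat_gt (1 / (‖β‖ - 1))
  have h0 : 0 < ‖β‖ - 1 := by linarith
  rw [div_lt_iff₀ h0] at hN
  nlinarith [key N]

end HardySpace

/-! ### Solutions B for given representations -/

open HardySpace

section Inner

variable {E E' F : Type*} [NormedAddCommGroup E] [InnerProductSpace ℂ E] [CompleteSpace E]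
  [NormedAddCommGroup E'] [InnerProductSpace ℂ E'] [CompleteSpace E']
  [NormedAddCommGroup F] [InnerProductSpace ℂ F] [CompleteSpace F]
  {Θ : ℂ → E →L[ℂ] F} {Θ' : ℂ → E' →L[ℂ] F} {A : F →L[ℂ] F} {S : Submodule ℂ (HardySpace F)}

theorem IsMultiplier.mulOp_mulZ (h : IsMultiplier Θ) (f : HardySpace E) :
    mulOp Θ (mulZ E f) = mulZ F (mulOp Θ f) :=
  ext_eval fun z hz => by
    rw [h.isMulBy_mulOp _ z hz, eval_mulZ _ hz, eval_mulZ _ hz, h.isMulBy_mulOp _ z hz, map_smul]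

theorem IsInnerFunction.inner_mulOp_mulOp (h : IsInnerFunction Θ) (f g : HardySpace E) :
    inner ℂ (mulOp Θ f) (mulOp Θ g) = inner ℂ f g :=
  (⟨(mulOp Θ).toLinearMap, h.isometry⟩ : HardySpace E →ₗᵢ[ℂ] HardySpace F).inner_map_map f g

theorem IsInnerFunction.mulOp_injective (h : IsInnerFunction Θ) :
    Function.Injective (mulOp Θ) :=
  (⟨(mulOp Θ).toLinearMap, h.isometry⟩ : HardySpace E →ₗᵢ[ℂ] HardySpace F).injective

theorem IsInnerFunction.adjoint_mulOp_mulOp (h : IsInnerFunction Θ) (f : HardySpace E) :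
    ContinuousLinearMap.adjoint (mulOp Θ) (mulOp Θ f) = f :=
  ext_inner_right ℂ fun g => by
    rw [ContinuousLinearMap.adjoint_inner_left, h.inner_mulOp_mulOp]

theorem IsBLHRepresentation.mem_iff (h : IsBLHRepresentation S Θ) (f : HardySpace F) :
    f ∈ S ↔ ∃ g, mulOp Θ g = f := by
  rw [← SetLike.mem_coe, h.2, Set.mem_range]

theorem IsBLHRepresentation.mulOp_adjoint_of_mem (h : IsBLHRepresentation S Θ) {f : HardySpace F}
    (hf : f ∈ S) : mulOp Θ (ContinuousLinearMap.adjoint (mulOp Θ) f) = f := by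
  obtain ⟨g, rfl⟩ := (h.mem_iff f).1 hf
  rw [h.1.adjoint_mulOp_mulOp]

/-- The operators `B + B* M_z` are the operators `X` that commute with `M_z` and satisfy
`X = X* M_z`. -/
theorem HardySpace.exists_eq_gammaOp {X : HardySpace E →L[ℂ] HardySpace E}
    (hX : ∀ f, X (mulZ E f) = mulZ E (X f))
    (hX' : ∀ f g, inner ℂ (X f) g = inner ℂ (mulZ E f) (X g)) :
    ∃ B : E →L[ℂ] E, X = gammaOp B := by
  let B : E →L[ℂ] E := coeffL E 0 ∘L X ∘L (constL E).toContinuousLinearMap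
  have hB : ∀ x, B x = X (const x) 0 := fun x => rfl
  refine ⟨B, ext_of_commute_mulZ hX (gammaOp_mulZ B) fun x => ?_⟩
  refine lp.ext (funext fun k => ?_)
  rcases k with _ | _ | k
  · simp [hB]
  · have h1 : X (const x) 1 = ContinuousLinearMap.adjoint B x := by
      refine ext_inner_right ℂ fun y => ?_
      have h2 : inner ℂ (X (const x) 1) y = inner ℂ (X (const x)) (mulZ E (const y)) := by
        have := lp.inner_single_right (𝕜 := ℂ) 1 y (X (const x))
        rw [← this, ← iterate_mulZ_const]
        rfl
      -- ⟨Xx, zy⟩ = ⟨zx, X(zy)⟩ = ⟨zx, zXy⟩ = ⟨x, Xy⟩ = ⟨x, By⟩.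
      rw [h2, hX', hX, inner_mulZ_mulZ, inner_const_left, ContinuousLinearMap.adjoint_inner_left,
        hB]
    simp [h1]
  -- ⟨Xx, z^(k+2) y⟩ = ⟨zx, z^(k+2) Xy⟩ = ⟨x, z^(k+1) Xy⟩, which vanishes because the second entry
  -- has no constant term.
  · have h1 : X (const x) (k + 2) = 0 := by
      refine ext_inner_right ℂ fun y => ?_
      have := lp.inner_single_right (𝕜 := ℂ) (k + 2) y (X (const x))
      rw [← this, ← iterate_mulZ_const, Function.iterate_succ_apply', hX', hX, inner_mulZ_mulZ,
        Function.iterate_succ_apply', hX]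
      simp
    simp [h1]

theorem IsBLHRepresentation.isGammaSubmodule (h : IsBLHRepresentation S Θ) {B : E →L[ℂ] E}
    (hB : IsGammaSolution A Θ B) : IsGammaSubmodule A S := by
  constructor
  · intro f hf
    obtain ⟨g, rfl⟩ := (h.mem_iff f).1 hf
    exact (h.mem_iff _).2 ⟨gammaOp B g, (DFunLike.congr_fun hB.2 g).symm⟩
  · intro f hf
    obtain ⟨g, rfl⟩ := (h.mem_iff f).1 hf
    exact (h.mem_iff _).2 ⟨mulZ E g, h.1.multiplier.mulOp_mulZ g⟩

/-- Since M_Θ M_Θ* fixes S and S is invariant, the compression X = M_Θ* Γ_A M_Θ is a genuine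
restriction: M_Θ X = Γ_A M_Θ. Being isometric and commuting with the shifts, M_Θ transfers to X the
algebraic identities of Γ_A and its quadratic form bound. -/
theorem IsBLHRepresentation.exists_isGammaSolution (h : IsBLHRepresentation S Θ)
    (hA : numericalRadius A ≤ 1) (hS : IsGammaSubmodule A S) :
    ∃ B : E →L[ℂ] E, IsGammaSolution A Θ B := by
  let X : HardySpace E →L[ℂ] HardySpace E :=
    ContinuousLinearMap.adjoint (mulOp Θ) ∘L gammaOp A ∘L mulOp Θ
  have hTX : ∀ f, mulOp Θ (X f) = gammaOp A (mulOp Θ f) := fun f =>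
    h.mulOp_adjoint_of_mem (hS.1 _ ((h.mem_iff _).2 ⟨f, rfl⟩))
  have hX : ∀ f, X (mulZ E f) = mulZ E (X f) := fun f => h.1.mulOp_injective (by
    rw [hTX, h.1.multiplier.mulOp_mulZ, h.1.multiplier.mulOp_mulZ, hTX, gammaOp_mulZ])
  have hX' : ∀ f g, inner ℂ (X f) g = inner ℂ (mulZ E f) (X g) := fun f g => by
    rw [← h.1.inner_mulOp_mulOp, ← h.1.inner_mulOp_mulOp, hTX, hTX, h.1.multiplier.mulOp_mulZ,
      inner_gammaOp_left]
  obtain ⟨B, hB⟩ := exists_eq_gammaOp hX hX'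
  refine ⟨B, numericalRadius_le_of_gammaOp fun f => ?_, ?_⟩
  · rw [← hB, ← h.1.inner_mulOp_mulOp, hTX, ← h.1.isometry f]
    exact norm_inner_gammaOp_self_le hA _
  · rw [← hB]
    exact ContinuousLinearMap.ext fun f => (hTX f).symm

theorem IsInnerFunction.isGammaSolution_unique (h : IsInnerFunction Θ) {B B' : E →L[ℂ] E}
    (hB : IsGammaSolution A Θ B) (hB' : IsGammaSolution A Θ B') : B = B' := by
  refine ContinuousLinearMap.ext fun x => ?_
  have e : gammaOp B (const x) = gammaOp B' (const x) :=
    h.mulOp_injective (DFunLike.congr_fun (hB.2.symm.trans hB'.2) (const x))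
  simpa using congrArg (fun f : HardySpace E => f 0) e

/-- Constants map into S ⊖ zS under either representation. So if M_Θ' g = M_Θ x, then g is
orthogonal to every z^(k+1) y: the vector M_Θ'(z^(k+1) y) lies in zS = M_Θ(zH²), which is orthogonal
to M_Θ x. Hence g is constant. -/
theorem IsBLHRepresentation.exists_mulOp_const (h : IsBLHRepresentation S Θ)
    (h' : IsBLHRepresentation S Θ') (x : E) :
    ∃ y : E', mulOp Θ (const x) = mulOp Θ' (const y) := by
  have hm : ∀ f, mulOp Θ f ∈ S := fun f => (h.mem_iff _).2 ⟨f, rfl⟩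
  obtain ⟨g, hg⟩ := (h'.mem_iff _).1 (hm (const x))
  refine ⟨g 0, ?_⟩
  rw [← hg]
  congr 1
  refine lp.ext (funext fun k => ?_)
  rcases k with _ | k
  · simp
  · rw [const_succ_coeff]
    refine ext_inner_right ℂ fun y => ?_
    rw [← lp.inner_single_right (𝕜 := ℂ), ← iterate_mulZ_const, Function.iterate_succ_apply',
      ← h'.1.inner_mulOp_mulOp, hg, h'.1.multiplier.mulOp_mulZ]
    obtain ⟨f, hf⟩ := (h.mem_iff _).1
      ((h'.mem_iff (mulOp Θ' ((mulZ E')^[k] (const y)))).2 ⟨_, rfl⟩)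
    rw [← hf, ← h.1.multiplier.mulOp_mulZ, h.1.inner_mulOp_mulOp]
    simp

theorem IsBLHRepresentation.exists_linearIsometryEquiv (h : IsBLHRepresentation S Θ)
    (h' : IsBLHRepresentation S Θ') :
    ∃ W : E ≃ₗᵢ[ℂ] E', ∀ x, mulOp Θ (const x) = mulOp Θ' (const (W x)) := by
  choose W hW using h.exists_mulOp_const h'
  choose W' hW' using h'.exists_mulOp_const h
  have inj : Function.Injective fun x : E => mulOp Θ (const x) :=
    h.1.mulOp_injective.comp (constL E).injective
  have inj' : Function.Injective fun x : E' => mulOp Θ' (const x) :=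
    h'.1.mulOp_injective.comp (constL E').injective
  refine ⟨{
    toFun := W
    invFun := W'
    left_inv := fun x => inj ((hW' _).symm.trans (hW x).symm)
    right_inv := fun x => inj' ((hW _).symm.trans (hW' x).symm)
    map_add' := fun x y => inj' (by simp only [← hW, const_add, map_add])
    map_smul' := fun c x => inj' (by simp only [← hW, const_smul, map_smul, RingHom.id_apply])
    norm_map' := fun x => ?_ }, hW⟩
  change ‖W x‖ = ‖x‖
  rw [← norm_const (W x), ← h'.1.isometry, ← hW, h.1.isometry, norm_const]

/-- Evaluating M_Θ x = M_Θ'(Wx) at z relates the symbols. Applying Γ_A to it gives Γ_B'(Wx) = WBx +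
z WB*x after cancelling M_Θ', and the constant terms are B'Wx and WBx. -/
theorem IsBLHRepresentation.exists_intertwining (h : IsBLHRepresentation S Θ)
    (h' : IsBLHRepresentation S Θ') {B : E →L[ℂ] E} {B' : E' →L[ℂ] E'}
    (hB : IsGammaSolution A Θ B) (hB' : IsGammaSolution A Θ' B') :
    ∃ W : E ≃ₗᵢ[ℂ] E', (∀ z ∈ Metric.ball (0 : ℂ) 1, ∀ x, Θ z x = Θ' z (W x)) ∧
      ∀ x, W (B x) = B' (W x) := by
  obtain ⟨W, hW⟩ := h.exists_linearIsometryEquiv h'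
  refine ⟨W, fun z hz x => ?_, fun x => ?_⟩
  · have h1 := h.1.multiplier.isMulBy_mulOp (const x) z hz
    have h2 := h'.1.multiplier.isMulBy_mulOp (const (W x)) z hz
    rw [eval_const] at h1 h2
    rw [← h1, ← h2, hW]
  · have h1 : gammaOp A (mulOp Θ (const x)) = mulOp Θ (gammaOp B (const x)) :=
      DFunLike.congr_fun hB.2 (const x)
    have h2 : gammaOp A (mulOp Θ' (const (W x))) = mulOp Θ' (gammaOp B' (const (W x))) :=
      DFunLike.congr_fun hB'.2 (const (W x))
    rw [hW, h2, gammaOp_const B, map_add, h.1.multiplier.mulOp_mulZ, hW, hW,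
      ← h'.1.multiplier.mulOp_mulZ, ← map_add] at h1
    have h3 := congrArg (fun f : HardySpace E' => f 0) (h'.1.mulOp_injective h1)
    simpa using h3.symm

end Inner

/-! ### Power series, separability and the Szegő kernel -/

/-- Analyticity of the sum of a power series with bounded operator coefficients. -/
theorem differentiableOn_tsum_pow_smul {G : Type*} [NormedAddCommGroup G] [NormedSpace ℂ G]
    [CompleteSpace G] {C : ℕ → G} {c : ℝ} (hC : ∀ n, ‖C n‖ ≤ c) :
    DifferentiableOn ℂ (fun z : ℂ => ∑' n, z ^ n • C n) (Metric.ball 0 1) := by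
  have h : HasFPowerSeriesOnBall (fun z : ℂ => ∑' n, z ^ n • C n)
      (fun n => ContinuousMultilinearMap.mkPiRing ℂ (Fin n) (C n)) 0 1 := by
    refine ⟨?_, by norm_num, ?_⟩
    · refine FormalMultilinearSeries.le_radius_of_bound (r := 1) _ c fun n => ?_
      simpa using hC n
    · intro y hy
      have hy' : ‖y‖ < 1 := by
        have : y ∈ Metric.ball (0 : ℂ) 1 := by simpa [← Metric.eball_ofReal] using hy
        simpa using this
      have hs : Summable fun n => y ^ n • C n := by
        refine Summable.of_norm_bounded
          ((summable_geometric_of_lt_one (norm_nonneg y) hy').mul_right c) fun n => ?_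
        rw [norm_smul, norm_pow]
        exact mul_le_mul_of_nonneg_left (hC n) (by positivity)
      simpa using hs.hasSum
  have := h.differentiableOn
  rwa [← ENNReal.ofReal_one, Metric.eball_ofReal] at this

namespace HardySpace

variable {F : Type*} [NormedAddCommGroup F] [InnerProductSpace ℂ F]

/-- Monomials zⁿx have dense span. This makes the wandering subspace, the coefficient space of the
constructed representation, separable. -/
instance instSeparableSpace [TopologicalSpace.SeparableSpace F] :
    TopologicalSpace.SeparableSpace (HardySpace F) := by
  rw [← TopologicalSpace.isSeparable_univ_iff]
  have h : TopologicalSpace.IsSeparable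
      (⋃ n : ℕ, Set.range fun x : F => (lp.single 2 n x : HardySpace F)) :=
    TopologicalSpace.IsSeparable.iUnion fun n =>
      TopologicalSpace.isSeparable_range
        (lp.isometry_single (E := fun _ : ℕ => F) (p := 2) n).continuous
  refine (h.span (R := ℂ)).closure.mono fun f _ => ?_
  refine mem_closure_of_tendsto
    (lp.hasSum_single (E := fun _ : ℕ => F) (p := 2) (by norm_num) f)
    (Filter.Eventually.of_forall fun s => Submodule.sum_mem _ fun n _ => ?_)
  exact Submodule.subset_span (Set.mem_iUnion.2 ⟨n, Set.mem_range_self _⟩)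

variable [CompleteSpace F]

/-- The Szegő kernel function `w ↦ ∑ (conj z)ⁿ wⁿ x`. -/
theorem exists_kernel (z : ℂ) (hz : z ∈ Metric.ball (0 : ℂ) 1) (x : F) :
    ∃ K : HardySpace F, ∀ n, K n = (starRingEnd ℂ) z ^ n • x := by
  have hz' : ‖z‖ < 1 := by simpa using hz
  refine ⟨⟨fun n => (starRingEnd ℂ) z ^ n • x, memℓp_gen ?_⟩, fun n => rfl⟩
  have h1 : ‖z‖ ^ 2 < 1 := by nlinarith [norm_nonneg z]
  refine ((summable_geometric_of_lt_one (by positivity) h1).mul_right (‖x‖ ^ 2)).congr fun n => ?_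
  norm_num [norm_smul]
  ring

theorem inner_kernel {z : ℂ} (hz : z ∈ Metric.ball (0 : ℂ) 1) {x : F} {K : HardySpace F}
    (hK : ∀ n, K n = (starRingEnd ℂ) z ^ n • x) (f : HardySpace F) :
    inner ℂ K f = inner ℂ x (f.eval z) := by
  have h := (innerSL ℂ x).map_tsum (f.summable_eval hz)
  rw [lp.inner_eq_tsum, eval]
  refine Eq.trans (tsum_congr fun n => ?_) h.symm
  rw [hK, inner_smul_left, innerSL_apply_apply, inner_smul_right, map_pow, Complex.conj_conj]

theorem eval_kernel {z : ℂ} (hz : z ∈ Metric.ball (0 : ℂ) 1) {x : F} {K : HardySpace F}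
    (hK : ∀ n, K n = (starRingEnd ℂ) z ^ n • x) :
    K.eval z = (((1 - ‖z‖ ^ 2)⁻¹ : ℝ) : ℂ) • x := by
  have hz' : ‖z‖ < 1 := by simpa using hz
  have h1 : ‖z‖ ^ 2 < 1 := by nlinarith [norm_nonneg z]
  have h : HasSum (fun n => (((‖z‖ ^ 2) ^ n : ℝ) : ℂ) • x) ((((1 - ‖z‖ ^ 2)⁻¹ : ℝ) : ℂ) • x) :=
    (Complex.hasSum_ofReal.2 (hasSum_geometric_of_lt_one (by positivity) h1)).smul_const x
  rw [eval, ← h.tsum_eq]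
  refine tsum_congr fun n => ?_
  rw [hK, smul_smul, ← mul_pow, Complex.mul_conj, Complex.normSq_eq_norm_sq]
  push_cast
  rfl

theorem inner_self_eq_ofReal_norm_sq {E : Type*} [NormedAddCommGroup E] [InnerProductSpace ℂ E]
    (x : E) : inner ℂ x x = ((‖x‖ ^ 2 : ℝ) : ℂ) := by
  rw [Complex.ofReal_pow]
  exact inner_self_eq_norm_sq_to_K x

/-- A contractive multiplication operator has a symbol bounded by `1`. -/
theorem norm_le_of_isMulBy {E : Type*} [NormedAddCommGroup E] [InnerProductSpace ℂ E]
    [CompleteSpace E] {Φ : ℂ → E →L[ℂ] F} {T : HardySpace E →L[ℂ] HardySpace F}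
    (hT : IsMulBy Φ T) (hT1 : ∀ f, ‖T f‖ ≤ ‖f‖) {z : ℂ} (hz : z ∈ Metric.ball (0 : ℂ) 1) :
    ‖Φ z‖ ≤ 1 := by
  refine ContinuousLinearMap.opNorm_le_bound _ zero_le_one fun x => ?_
  rw [one_mul]
  have hz' : ‖z‖ < 1 := by simpa using hz
  set c : ℝ := (1 - ‖z‖ ^ 2)⁻¹ with hc
  have hc0 : 0 < c := inv_pos.2 (by nlinarith [norm_nonneg z])
  obtain ⟨K, hK⟩ := exists_kernel z hz x
  obtain ⟨K', hK'⟩ := exists_kernel z hz (Φ z x)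
  have n1 : ‖K‖ ^ 2 = c * ‖x‖ ^ 2 := by
    have h := inner_kernel hz hK K
    rw [eval_kernel hz hK, inner_smul_right, inner_self_eq_ofReal_norm_sq,
      inner_self_eq_ofReal_norm_sq, ← Complex.ofReal_mul] at h
    exact Complex.ofReal_injective h
  have n2 : ‖K'‖ ^ 2 = c * ‖Φ z x‖ ^ 2 := by
    have h := inner_kernel hz hK' K'
    rw [eval_kernel hz hK', inner_smul_right, inner_self_eq_ofReal_norm_sq,
      inner_self_eq_ofReal_norm_sq, ← Complex.ofReal_mul] at h
    exact Complex.ofReal_injective h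
  -- With c = (1 - |z|²)⁻¹, pairing the kernel at Φ(z)x with T applied to the kernel at x gives
  -- c‖Φ(z)x‖²; the kernels have squared norms c‖Φ(z)x‖² and c‖x‖², so Cauchy–Schwarz yields the
  -- bound.
  have h := inner_kernel hz hK' (T K)
  rw [hT K z hz, eval_kernel hz hK, map_smul, inner_smul_right, inner_self_eq_norm_sq_to_K] at h
  have h3 : c * ‖Φ z x‖ ^ 2 ≤ ‖K'‖ * ‖K‖ := by
    have h4 : ‖(inner ℂ K' (T K) : ℂ)‖ = c * ‖Φ z x‖ ^ 2 := by
      rw [h, norm_mul, Complex.norm_of_nonneg hc0.le]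
      simp
    rw [← h4]
    exact (norm_inner_le_norm _ _).trans (mul_le_mul_of_nonneg_left (hT1 K) (norm_nonneg _))
  rw [← n2, sq] at h3
  rcases (norm_nonneg K').eq_or_lt with h0 | h0
  · rw [← h0] at n2
    have : ‖Φ z x‖ ^ 2 = 0 := by
      rcases mul_eq_zero.1 (n2.symm.trans (by norm_num)) with h | h
      · exact absurd h hc0.ne'
      · exact h
    rw [pow_eq_zero_iff two_ne_zero] at this
    rw [this]
    exact norm_nonneg x
  · have h5 : ‖K'‖ ≤ ‖K‖ := le_of_mul_le_mul_left h3 h0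
    have h6 : c * ‖Φ z x‖ ^ 2 ≤ c * ‖x‖ ^ 2 := by
      rw [← n1, ← n2]
      exact pow_le_pow_left₀ (norm_nonneg _) h5 2
    exact le_of_sq_le_sq (le_of_mul_le_mul_left h6 hc0) (norm_nonneg _)

theorem iterate_mulZ_coeff_of_lt (f : HardySpace F) {n k : ℕ} (h : k < n) :
    (mulZ F)^[n] f k = 0 := by
  induction n generalizing k with
  | zero => omega
  | succ n ih =>
    rw [Function.iterate_succ_apply']
    cases k with
    | zero => simp
    | succ k => simpa using ih (by omega)

theorem inner_iterate_mulZ (f g : HardySpace F) (n : ℕ) :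
    inner ℂ ((mulZ F)^[n] f) ((mulZ F)^[n] g) = inner ℂ f g := by
  induction n with
  | zero => rfl
  | succ n ih => rw [Function.iterate_succ_apply', Function.iterate_succ_apply', inner_mulZ_mulZ, ih]

theorem eval_iterate_mulZ (f : HardySpace F) {z : ℂ} (hz : z ∈ Metric.ball (0 : ℂ) 1) (n : ℕ) :
    ((mulZ F)^[n] f).eval z = z ^ n • f.eval z := by
  induction n with
  | zero => simp
  | succ n ih => rw [Function.iterate_succ_apply', eval_mulZ _ hz, ih, smul_smul, pow_succ']

/-! ### Wold decomposition and the Beurling–Lax–Halmos theorem -/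

/-- The wandering subspace `S ⊖ z S`. -/
noncomputable def wandering (S : Submodule ℂ (HardySpace F)) : Submodule ℂ (HardySpace F) :=
  S ⊓ (S.map (mulZ F).toLinearMap)ᗮ

theorem iterate_mulZ_mem {S : Submodule ℂ (HardySpace F)} (hz : ∀ f ∈ S, mulZ F f ∈ S)
    {f : HardySpace F} (hf : f ∈ S) (n : ℕ) : (mulZ F)^[n] f ∈ S := by
  induction n with
  | zero => exact hf
  | succ n ih => rw [Function.iterate_succ_apply']; exact hz _ ih

theorem inner_iterate_mulZ_of_mem_wandering {S : Submodule ℂ (HardySpace F)}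
    (hz : ∀ f ∈ S, mulZ F f ∈ S) {f g : HardySpace F} (hf : f ∈ wandering S) (hg : g ∈ S)
    {m n : ℕ} (h : m < n) : inner ℂ ((mulZ F)^[m] f) ((mulZ F)^[n] g) = 0 := by
  obtain ⟨k, rfl⟩ := Nat.exists_eq_add_of_lt h
  have h0 : inner ℂ (mulZ F ((mulZ F)^[k] g)) f = 0 := (Submodule.mem_orthogonal _ _).1 hf.2 _
    (Submodule.mem_map_of_mem (iterate_mulZ_mem hz hg k))
  rw [add_assoc, Function.iterate_add_apply, inner_iterate_mulZ, Function.iterate_succ_apply',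
    ← inner_conj_symm, h0, map_zero]

/-- The operator `M_zⁿ` as a linear isometry. -/
noncomputable def mulZPow (F : Type*) [NormedAddCommGroup F] [InnerProductSpace ℂ F]
    [CompleteSpace F] : ℕ → HardySpace F →ₗᵢ[ℂ] HardySpace F
  | 0 => LinearIsometry.id
  | n + 1 => (mulZₗᵢ F).comp (mulZPow F n)

theorem mulZPow_apply (f : HardySpace F) (n : ℕ) : mulZPow F n f = (mulZ F)^[n] f := by
  induction n with
  | zero => rfl
  | succ n ih =>
    rw [Function.iterate_succ_apply', ← ih]
    rfl

/-- The embedding `f ↦ zⁿ f` of the wandering subspace. -/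
noncomputable def wanderingPow (S : Submodule ℂ (HardySpace F)) (n : ℕ) :
    wandering S →ₗᵢ[ℂ] HardySpace F :=
  (mulZPow F n).comp (wandering S).subtypeₗᵢ

theorem wanderingPow_apply (S : Submodule ℂ (HardySpace F)) (n : ℕ) (f : wandering S) :
    wanderingPow S n f = (mulZ F)^[n] (f : HardySpace F) :=
  mulZPow_apply _ n

theorem orthogonalFamily_wanderingPow {S : Submodule ℂ (HardySpace F)}
    (hz : ∀ f ∈ S, mulZ F f ∈ S) :
    OrthogonalFamily ℂ (fun _ : ℕ => wandering S) (wanderingPow S) := by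
  intro m n hmn f g
  rw [wanderingPow_apply, wanderingPow_apply]
  rcases hmn.lt_or_gt with h | h
  · exact inner_iterate_mulZ_of_mem_wandering hz f.2 g.2.1 h
  · rw [← inner_conj_symm, inner_iterate_mulZ_of_mem_wandering hz g.2 f.2.1 h, map_zero]

theorem isClosed_wandering {S : Submodule ℂ (HardySpace F)}
    (hS : IsClosed (S : Set (HardySpace F))) :
    IsClosed (wandering S : Set (HardySpace F)) :=
  hS.inter (Submodule.isClosed_orthogonal _)

/-- The subspace zS is closed because M_z is isometric, so f splits along zS and its complement. The
second part lies in S ⊖ zS and, f being orthogonal to that space, vanishes. -/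
theorem exists_mulZ_eq_of_orthogonal_wandering {S : Submodule ℂ (HardySpace F)}
    (hS : IsClosed (S : Set (HardySpace F))) (hz : ∀ f ∈ S, mulZ F f ∈ S)
    {f : HardySpace F} (hf : f ∈ S) (hfw : f ∈ (wandering S)ᗮ) : ∃ g ∈ S, mulZ F g = f := by
  have hcl : IsClosed ((S.map (mulZ F).toLinearMap : Submodule ℂ (HardySpace F)) :
      Set (HardySpace F)) :=
    (mulZₗᵢ F).isometry.isClosedEmbedding.isClosedMap _ hS
  have : CompleteSpace (S.map (mulZ F).toLinearMap : Submodule ℂ (HardySpace F)) :=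
    hcl.completeSpace_coe
  obtain ⟨p, hp, q, hq, rfl⟩ :=
    (S.map (mulZ F).toLinearMap).exists_add_mem_mem_orthogonal f
  have hpS : p ∈ S := by
    obtain ⟨g, hg, rfl⟩ := hp
    exact hz g hg
  have hqS : q ∈ S := by simpa using S.sub_mem hf hpS
  have h1 := (Submodule.mem_orthogonal _ _).1 hfw q ⟨hqS, hq⟩
  rw [inner_add_right, ← inner_conj_symm, (Submodule.mem_orthogonal _ _).1 hq p hp, map_zero,
    zero_add, inner_self_eq_zero] at h1
  obtain ⟨g, hg, hgp⟩ := hp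
  exact ⟨g, hg, by rw [h1, add_zero]; exact hgp⟩

/-- The Wold decomposition has no unitary part here: what is left in S after removing all zⁿ(S ⊖ zS)
lies in every zⁿS, so all its coefficients vanish. -/
theorem range_linearIsometry_wandering {S : Submodule ℂ (HardySpace F)}
    (hS : IsClosed (S : Set (HardySpace F))) (hz : ∀ f ∈ S, mulZ F f ∈ S) :
    LinearMap.range (orthogonalFamily_wanderingPow hz).linearIsometry.toLinearMap = S := by
  have : CompleteSpace (wandering S) := (isClosed_wandering hS).completeSpace_coe
  rw [OrthogonalFamily.range_linearIsometry]
  set P : Submodule ℂ (HardySpace F) := ⨆ n, LinearMap.range (wanderingPow S n).toLinearMap with hP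
  have hmem : ∀ n, ∀ f ∈ wandering S, (mulZ F)^[n] f ∈ P := fun n f hf =>
    Submodule.mem_iSup_of_mem n ⟨⟨f, hf⟩, wanderingPow_apply S n ⟨f, hf⟩⟩
  have hle : P.topologicalClosure ≤ S := by
    refine Submodule.topologicalClosure_minimal _ (iSup_le fun n => ?_) hS
    rintro _ ⟨f, rfl⟩
    have := iterate_mulZ_mem hz f.2.1 n
    rwa [← wanderingPow_apply] at this
  have : CompleteSpace P.topologicalClosure :=
    P.isClosed_topologicalClosure.completeSpace_coe
  rw [← Submodule.sup_orthogonal_inf_of_hasOrthogonalProjection hle]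
  refine (sup_eq_left.2 fun f hf => ?_).symm
  have hfP : ∀ n, ∀ e ∈ wandering S, inner ℂ ((mulZ F)^[n] e) f = 0 := fun n e he =>
    (Submodule.mem_orthogonal _ _).1 hf.1 _ (P.le_topologicalClosure (hmem n e he))
  -- If f = zⁿs, orthogonality of f to zⁿ(S ⊖ zS) makes s orthogonal to S ⊖ zS, so another factor z
  -- splits off.
  have key : ∀ n, ∃ s ∈ S, f = (mulZ F)^[n] s := by
    intro n
    induction n with
    | zero => exact ⟨f, hf.2, rfl⟩
    | succ n ih =>
      obtain ⟨s, hs, hfs⟩ := ih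
      obtain ⟨g, hg, rfl⟩ := exists_mulZ_eq_of_orthogonal_wandering hS hz hs
        ((Submodule.mem_orthogonal _ _).2 fun e he => by
          have := hfP n e he
          rwa [hfs, inner_iterate_mulZ] at this)
      exact ⟨g, hg, hfs⟩
  have h0 : f = 0 := lp.ext (funext fun k => by
    obtain ⟨s, _, hs⟩ := key (k + 1)
    rw [hs, iterate_mulZ_coeff_of_lt s k.lt_succ_self]
    rfl)
  rw [h0]
  exact Submodule.zero_mem _

section Symbol

variable {E : Type*} [NormedAddCommGroup E] [InnerProductSpace ℂ E]

/-- The operator-valued analytic function `z ↦ (x ↦ (R x)(z))` defined by `R : E → H²_F(𝔻)`. -/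
noncomputable def symbol (R : E →L[ℂ] HardySpace F) (z : ℂ) : E →L[ℂ] F :=
  ∑' n, z ^ n • (coeffL F n ∘L R)

theorem norm_coeffL_comp_le (R : E →L[ℂ] HardySpace F) (n : ℕ) : ‖coeffL F n ∘L R‖ ≤ ‖R‖ :=
  (ContinuousLinearMap.opNorm_comp_le _ _).trans
    (mul_le_of_le_one_left (norm_nonneg R) (norm_coeffL_le n))

theorem differentiableOn_symbol (R : E →L[ℂ] HardySpace F) :
    DifferentiableOn ℂ (symbol R) (Metric.ball 0 1) :=
  differentiableOn_tsum_pow_smul (norm_coeffL_comp_le R)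

theorem symbol_apply (R : E →L[ℂ] HardySpace F) {z : ℂ} (hz : z ∈ Metric.ball (0 : ℂ) 1) (x : E) :
    symbol R z x = (R x).eval z := by
  have hz' : ‖z‖ < 1 := by simpa using hz
  have hs : Summable fun n => z ^ n • (coeffL F n ∘L R) := by
    refine Summable.of_norm_bounded
      ((summable_geometric_of_lt_one (norm_nonneg z) hz').mul_right ‖R‖) fun n => ?_
    rw [norm_smul, norm_pow]
    exact mul_le_mul_of_nonneg_left (norm_coeffL_comp_le R n) (by positivity)
  exact (ContinuousLinearMap.apply ℂ F x).map_tsum hs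

end Symbol

/-- The **Beurling–Lax–Halmos theorem**. -/
theorem isBLHRepresentation_symbol {S : Submodule ℂ (HardySpace F)}
    (hS : IsClosed (S : Set (HardySpace F))) (hz : ∀ f ∈ S, mulZ F f ∈ S) :
    IsBLHRepresentation S (symbol (wandering S).subtypeL) := by
  have : CompleteSpace (wandering S) := (isClosed_wandering hS).completeSpace_coe
  let T := (orthogonalFamily_wanderingPow hz).linearIsometry
  have hT : IsMulBy (symbol (wandering S).subtypeL) T.toContinuousLinearMap := by
    -- T sends (fₙ) to ∑ zⁿfₙ, with each fₙ in the wandering subspace regarded as a function;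
    -- evaluating termwise shows that T multiplies by the symbol whose value at z is evaluation at
    -- z.
    intro f z hz'
    have h1 := ((orthogonalFamily_wanderingPow hz).hasSum_linearIsometry f).mapL (evalL F z hz')
    have h2 := (f.summable_eval hz').hasSum.mapL (symbol (wandering S).subtypeL z)
    refine h1.unique (h2.congr_fun fun n => ?_)
    rw [wanderingPow_apply, evalL_apply, eval_iterate_mulZ _ hz', map_smul,
      symbol_apply _ hz']
    rfl
  have hT' := hT.mulOp_eq
  refine ⟨⟨differentiableOn_symbol _,
    ⟨1, fun z hz' => norm_le_of_isMulBy hT (fun f => (T.norm_map f).le) hz'⟩, ⟨_, hT⟩, fun f => ?_⟩, ?_⟩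
  · rw [hT']
    exact T.norm_map f
  · rw [hT']
    exact congrArg (fun P : Submodule ℂ (HardySpace F) => (P : Set (HardySpace F)))
      (range_linearIsometry_wandering hS hz).symm

end HardySpace

/-! ### The theorem -/

theorem mainTheorem1 {F : Type u} [NormedAddCommGroup F] [InnerProductSpace ℂ F]
    [CompleteSpace F] [TopologicalSpace.SeparableSpace F]
    (S : Submodule ℂ (HardySpace F)) (hS : IsClosed (S : Set (HardySpace F))) (hS0 : S ≠ ⊥)
    (A : F →L[ℂ] F) (hA : numericalRadius A ≤ 1) :
    -- `S` is a submodule iff it has a representation `Θ` for which a solution `B` exists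
    (IsGammaSubmodule A S ↔
      ∃ (E : Type u) (_ : NormedAddCommGroup E) (_ : InnerProductSpace ℂ E)
        (_ : CompleteSpace E) (_ : TopologicalSpace.SeparableSpace E)
        (Θ : ℂ → E →L[ℂ] F) (B : E →L[ℂ] E),
        IsBLHRepresentation S Θ ∧ IsGammaSolution A Θ B) ∧
    -- the same equivalence for every given representation `Θ`; `B` is unique once `Θ` is fixed
    (∀ (E : Type v) [NormedAddCommGroup E] [InnerProductSpace ℂ E] [CompleteSpace E]
      (Θ : ℂ → E →L[ℂ] F), IsBLHRepresentation S Θ →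
        (IsGammaSubmodule A S ↔ ∃ B : E →L[ℂ] E, IsGammaSolution A Θ B) ∧
        ∀ B B' : E →L[ℂ] E, IsGammaSolution A Θ B → IsGammaSolution A Θ B' → B = B') ∧
    -- solutions for two representations are unitarily equivalent, by a unitary relating these
    (∀ (E : Type v) [NormedAddCommGroup E] [InnerProductSpace ℂ E] [CompleteSpace E]
      (E' : Type w) [NormedAddCommGroup E'] [InnerProductSpace ℂ E'] [CompleteSpace E']
      (Θ : ℂ → E →L[ℂ] F) (Θ' : ℂ → E' →L[ℂ] F) (B : E →L[ℂ] E) (B' : E' →L[ℂ] E'),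
      IsBLHRepresentation S Θ → IsBLHRepresentation S Θ' →
      IsGammaSolution A Θ B → IsGammaSolution A Θ' B' →
        ∃ W : E ≃ₗᵢ[ℂ] E',
          (∀ z ∈ Metric.ball (0 : ℂ) 1, ∀ x : E, Θ z x = Θ' z (W x)) ∧
          ∀ x : E, W (B x) = B' (W x)) := by
  refine ⟨⟨fun h => ?_, ?_⟩, ?_, ?_⟩
  · have hΘ := isBLHRepresentation_symbol hS h.2
    have hc : CompleteSpace (wandering S) := (isClosed_wandering hS).completeSpace_coe
    obtain ⟨B, hB⟩ := hΘ.exists_isGammaSolution hA h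
    -- Second countability, unlike separability, passes to arbitrary subspaces, which gives
    -- separability of the wandering subspace.
    have := UniformSpace.secondCountable_of_separable (HardySpace F)
    exact ⟨wandering S, inferInstance, inferInstance, hc, inferInstance, _, B, hΘ, hB⟩
  · rintro ⟨E, _, _, _, _, Θ, B, hΘ, hB⟩
    exact hΘ.isGammaSubmodule hB
  · intro E _ _ _ Θ hΘ
    exact ⟨⟨hΘ.exists_isGammaSolution hA, fun ⟨B, hB⟩ => hΘ.isGammaSubmodule hB⟩,
      fun B B' => hΘ.1.isGammaSolution_unique⟩
  · intro E _ _ _ E' _ _ _ Θ Θ' B B' hΘ hΘ'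
    exact hΘ.exists_intertwining hΘ'
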